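/- **Setting.** Let $\mathcal X$ be a nonempty finite set, $k:\mathcal X\times\mathcal X\to\mathbb R$ a positive (semi)definite kernel with $k(x,x)\le 1$ for all $x$, and $\mathcal H_k$ its reproducing kernel Hilbert space. Let $(f_t)_{t\ge 1}$ be fixed (non-random) reward functions in $\mathcal H_k$ with $\|f_t\|_{\mathcal H_k}\le B$ for all $t$. Let $(\epsilon_t)_{t\ge1}$ be mutually independent $\rho$-sub-Gaussian random variables, $\mathbb E[\exp(\eta\epsilon_t)]\le\exp(\eta^2\rho^2/2)$ for all $\eta\in\mathbb R$, where $\rho\ge 0$. For $\lambda>0$, a finite sequence $X=(x_1,\dots,x_n)$ in $\mathcal X$ and $y\in\mathbb R^n$ put $\mathbf k(x,X)=[k(x,x_a)]_{a}$, $\mathbf K(X,X)=[k(x_a,x_b)]_{a,b}$, $$\mu(x;X,y)=\mathbf k(x,X)^\top(\mathbf K(X,X)+\lambda I_n)^{-1}y,\qquad \sigma^2(x;X)=k(x,x)-\mathbf k(x,X)^\top(\mathbf K(X,X)+\lambda I_n)^{-1}\mathbf k(x,X),$$ and $\sigma=\sqrt{\sigma^2}$. **Algorithm (R-PERP)** with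 horizon $T$, reset interval $H$ and width $\beta_T^{1/2}$. For each interval $i=1,\dots,\lceil T/H\rceil$, put $T^{(i)}=\min\{H,\,T-(i-1)H\}$, $\mathcal X_1^{(i)}=\mathcal X$, $N_0^{(i)}=1$, and for the batches $j=1,2,\dots$: 1. $N_j^{(i)}=\min\bigl\{\lceil\sqrt{T^{(i)}N_{j-1}^{(i)}}\,\rceil,\ T^{(i)}-\sum_{l=1}^{j-1}N_l^{(i)}\bigr\}$. 2. Successively for $m=1,\dots,N_j^{(i)}$ choose a candidate $\tilde x_{j,m}^{(i)}\in\arg\max_{x\in\mathcal X_j^{(i)}}\sigma^2\bigl(x;(\tilde x_{j,1}^{(i)},\dots,\tilde x_{j,m-1}^{(i)})\bigr)$, ties being broken by an arbitrary fixed rule that depends on $i$, $j$, $\mathcal X_j^{(i)}$ and the candidates already chosen in the batch. 3. Let $X_j^{(i)}=(x_{j,m}^{(i)})_{m\le N_j^{(i)}}$ be a uniformly random permutation of the sequence $(\tilde x_{j,m}^{(i)})_{m\le N_j^{(i)}}$. The permutations of the different batches are mutually independent, and jointly independent of the noise. 4. Observe $y_{j,m}^{(i)}=f_{j,m}^{(i)}(x_{j,m}^{(i)})+\epsilon_{j,m}^{(i)}$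 for $m\le N_j^{(i)}$, where $f_{j,m}^{(i)}=f_t$ and $\epsilon_{j,m}^{(i)}=\epsilon_t$ with $t=(i-1)H+\sum_{l=1}^{j-1}N_l^{(i)}+m$; put $y_j^{(i)}=(y_{j,m}^{(i)})_{m\le N_j^{(i)}}$. 5. If $\sum_{l=1}^{j}N_l^{(i)}=T^{(i)}$, the interval ends, and $Q^{(i)}:=j$ is its number of batches. Otherwise put $$\mathrm{lcb}_j^{(i)}(x)=\mu(x;X_j^{(i)},y_j^{(i)})-\beta_T^{1/2}\sigma(x;X_j^{(i)}),\qquad \mathrm{ucb}_j^{(i)}(x)=\mu(x;X_j^{(i)},y_j^{(i)})+\beta_T^{1/2}\sigma(x;X_j^{(i)}),$$ $$\mathcal X_{j+1}^{(i)}=\Bigl\{x\in\mathcal X_j^{(i)}:\ \mathrm{ucb}_j^{(i)}(x)\ge\max_{x'\in\mathcal X_j^{(i)}}\mathrm{lcb}_j^{(i)}(x')\Bigr\}.$$ **Theorem.** There is an absolute constant $C>0$ such that, in every setting as above, for all integers $2\le H\le T$ and all $\delta\in(0,1)$: if the algorithm is run with $$\beta_T^{1/2}=B\Bigl(\frac{C}{\sqrt\lambda}\sqrt{\ln\frac{4|\mathcal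 X|Q_{T,H}}{\delta}}+1\Bigr)+\frac{\rho}{\sqrt\lambda}\sqrt{2\ln\frac{4|\mathcal X|Q_{T,H}}{\delta}},\qquad Q_{T,H}=\Bigl\lceil\frac TH\Bigr\rceil\,(1+\log_2\log_2H),$$ then with probability at least $1-\delta$, simultaneously for all $i\le\lceil T/H\rceil$, all $1\le j\le Q^{(i)}-1$ and all $x\in\mathcal X$, $$\mathrm{lcb}_j^{(i)}(x)\ \le\ \overline f_j^{(i)}(x)\ \le\ \mathrm{ucb}_j^{(i)}(x),\qquad \overline f_j^{(i)}:=\frac1{N_j^{(i)}}\sum_{m=1}^{N_j^{(i)}}f_{j,m}^{(i)}.$$ -/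

import Mathlib

open MeasureTheory ProbabilityTheory
open scoped NNReal Matrix

namespace RPERP

noncomputable section

/-! ### Gaussian process posterior -/

section Posterior

variable {𝒳 : Type*} (k : 𝒳 → 𝒳 → ℝ) (lam : ℝ) {n : ℕ}

/-- The kernel vector `[k(x, x_i)]_i`. -/
def kernelVec (X : Fin n → 𝒳) (x : 𝒳) : Fin n → ℝ := fun a => k x (X a)

/-- The kernel matrix `[k(x_i, x_j)]_{i,j}`. -/
def kernelMat (X : Fin n → 𝒳) : Matrix (Fin n) (Fin n) ℝ :=
  Matrix.of fun a b => k (X a) (X b)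

/-- Posterior mean `μ(x; X, y)` with noise variance parameter `lam`. -/
def postMean (X : Fin n → 𝒳) (y : Fin n → ℝ) (x : 𝒳) : ℝ :=
  kernelVec k X x ⬝ᵥ ((kernelMat k X + lam • (1 : Matrix (Fin n) (Fin n) ℝ))⁻¹ *ᵥ y)

/-- Posterior variance `σ²(x; X)` with noise variance parameter `lam`. -/
def postVar (X : Fin n → 𝒳) (x : 𝒳) : ℝ :=
  k x x - kernelVec k X x ⬝ᵥ
    ((kernelMat k X + lam • (1 : Matrix (Fin n) (Fin n) ℝ))⁻¹ *ᵥ kernelVec k X x)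

/-- Posterior standard deviation `σ(x; X)`. -/
def postSd (X : Fin n → 𝒳) (x : 𝒳) : ℝ := √(postVar k lam X x)

end Posterior

/-! ### Deterministic schedule of the intervals and batches -/

/-- Length `T⁽ⁱ⁾ = min {H, T - (i-1)H}` of the `i`-th interval, for `i = 1, …, ⌈T/H⌉`. -/
def intervalLen (T H : ℕ) (i : ℕ+) : ℕ := min H (T - ((i : ℕ) - 1) * H)

/-- Batch sizes in an interval of length `L`: `N_0 = 1` and
`N_j = min {⌈√(L N_{j-1})⌉, L - ∑_{l=1}^{j-1} N_l}` (so `N_j = 0` once the interval is used up). -/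
def batchSize (L : ℕ) : ℕ → ℕ
  | 0 => 1
  | j + 1 => min ⌈√((L : ℝ) * (batchSize L j : ℝ))⌉₊ (L - ∑ l : Fin j, batchSize L (l + 1))
termination_by j => j
decreasing_by
  · omega
  · have := l.2
    omega

theorem batchSize_succ (L j : ℕ) :
    batchSize L (j + 1) = min ⌈√((L : ℝ) * (batchSize L j : ℝ))⌉₊
      (L - ∑ l ∈ Finset.Icc 1 j, batchSize L l) := by
  rw [batchSize, Fin.sum_univ_eq_sum_range (fun l => batchSize L (l + 1)) j,
    Finset.range_eq_Ico, Finset.sum_Ico_add' (fun l => batchSize L l) 0 j 1]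
  rfl

theorem exists_sum_batchSize_eq (L : ℕ) :
    ∃ j, ∑ l ∈ Finset.Icc 1 j, batchSize L l = L := by
  have hle : ∀ j, ∑ l ∈ Finset.Icc 1 j, batchSize L l ≤ L := by
    intro j
    induction j with
    | zero => simp
    | succ j ih =>
      rw [Finset.sum_Icc_succ_top (by omega), batchSize_succ]
      omega
  have key : ∀ j, ∑ l ∈ Finset.Icc 1 j, batchSize L l = L ∨
      (j ≤ ∑ l ∈ Finset.Icc 1 j, batchSize L l ∧ 0 < batchSize L j) := by
    intro j
    induction j with
    | zero => right; simp [batchSize]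
    | succ j ih =>
      have hb := batchSize_succ L j
      have hs : ∑ l ∈ Finset.Icc 1 (j + 1), batchSize L l =
          ∑ l ∈ Finset.Icc 1 j, batchSize L l + batchSize L (j + 1) :=
        Finset.sum_Icc_succ_top (by omega) _
      have hj := hle j
      rcases ih with h | ⟨h1, h2⟩
      · left; omega
      · by_cases hL : ∑ l ∈ Finset.Icc 1 j, batchSize L l = L
        · left; omega
        · right
          have hc : 0 < ⌈√((L : ℝ) * (batchSize L j : ℝ))⌉₊ := by
            have : 0 < L := by omega
            rw [Nat.ceil_pos]
            positivity
          omega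
  refine ⟨L, ?_⟩
  rcases key L with h | ⟨h, -⟩
  · exact h
  · exact le_antisymm (hle L) h

/-- Number `Q` of batches in an interval of length `L`: the first `j` with
`∑_{l=1}^{j} N_l = L`. -/
def numBatches (L : ℕ) : ℕ := Nat.find (exists_sum_batchSize_eq L)

/-- The size `N_j⁽ⁱ⁾` of the `j`-th batch of the `i`-th interval (for `j ≥ 1`). -/
abbrev size (T H : ℕ) (i : ℕ+) (j : ℕ) : ℕ := batchSize (intervalLen T H i) j

/-- Time step `(i-1)H + ∑_{l=1}^{j-1} N_l⁽ⁱ⁾ + m` of the `m`-th observation in the `j`-th batch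
of the `i`-th interval; here `m = 1, …, N_j⁽ⁱ⁾` is represented by an element of `Fin` (so
that `m - 1` is its value). -/
def time (T H : ℕ) (i : ℕ+) (j : ℕ) (m : Fin (size T H i j)) : ℕ+ :=
  Nat.succPNat (((i : ℕ) - 1) * H + ∑ l ∈ Finset.Icc 1 (j - 1), size T H i l + m)

/-- The quantity `Q_{T,H} = ⌈T/H⌉ (1 + log₂ log₂ H)`. -/
def QTH (T H : ℕ) : ℝ :=
  (⌈(T : ℝ) / (H : ℝ)⌉₊ : ℝ) * (1 + Real.logb 2 (Real.logb 2 (H : ℝ)))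

/-- The confidence width `β_T^{1/2}`; `card` is the number of inputs. -/
def sqrtBeta (T H card : ℕ) (B C lam ρ δ : ℝ) : ℝ :=
  B * (C / √lam * √(Real.log (4 * (card : ℝ) * QTH T H / δ)) + 1)
    + ρ / √lam * √(2 * Real.log (4 * (card : ℝ) * QTH T H / δ))

/-! ### The algorithm -/

/-- A rule that proposes the next query candidate from the interval, the batch, the set of potential
maximizers and the candidates already selected in the batch. -/
abbrev Rule (𝒳 : Type*) := ℕ+ → ℕ → Finset 𝒳 → (n : ℕ) → (Fin n → 𝒳) → 𝒳

/-- The rule maximizes the posterior variance over the set of potential maximizers (how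
ties are broken is left to the rule). -/
def Rule.IsArgmax {𝒳 : Type*} (rule : Rule 𝒳) (k : 𝒳 → 𝒳 → ℝ) (lam : ℝ) : Prop :=
  ∀ (i : ℕ+) (j : ℕ) (A : Finset 𝒳), A.Nonempty → ∀ (n : ℕ) (S : Fin n → 𝒳),
    rule i j A n S ∈ A ∧ ∀ x ∈ A, postVar k lam S x ≤ postVar k lam S (rule i j A n S)

/-- What the algorithm is run with: the horizon, the reset interval, the confidence width
`β_T^{1/2}`, the kernel, the noise variance parameter of the posterior, and the
selection rule for the query candidates. -/
structure Input (𝒳 : Type*) where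
  T : ℕ
  H : ℕ
  width : ℝ
  k : 𝒳 → 𝒳 → ℝ
  lam : ℝ
  rule : Rule 𝒳

/-- A realization of the permutations that the algorithm draws, one for each batch. -/
abbrev Perms (T H : ℕ) := ∀ (i : ℕ+) (j : ℕ), Equiv.Perm (Fin (size T H i j))

section Algorithm

variable {𝒳 : Type*} (I : Input 𝒳)

/-- The first `n` query candidates `x̃_1, …, x̃_n` selected one after the other from the set `A`. -/
def candidates (i : ℕ+) (j : ℕ) (A : Finset 𝒳) : (n : ℕ) → Fin n → 𝒳
  | 0 => Fin.elim0
  | n + 1 => Fin.snoc (candidates i j A n) (I.rule i j A n (candidates i j A n))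

/-- The query points `x_{j,1}, …, x_{j,N_j}`: the candidates in permuted order. -/
def queries (π : Perms I.T I.H) (i : ℕ+) (j : ℕ) (A : Finset 𝒳) :
    Fin (size I.T I.H i j) → 𝒳 :=
  fun m => candidates I i j A (size I.T I.H i j) (π i j m)

variable (f : ℕ+ → 𝒳 → ℝ) (e : ℕ+ → ℝ) (π : Perms I.T I.H)

/-- The observations `y_{j,m} = f_{j,m}(x_{j,m}) + ε_{j,m}`. -/
def observations (i : ℕ+) (j : ℕ) (A : Finset 𝒳) : Fin (size I.T I.H i j) → ℝ :=
  fun m => f (time I.T I.H i j m) (queries I π i j A m) + e (time I.T I.H i j m)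

/-- Lower confidence bound of a batch run with the set `A` of potential maximizers. -/
def lcbWith (i : ℕ+) (j : ℕ) (A : Finset 𝒳) (x : 𝒳) : ℝ :=
  postMean I.k I.lam (queries I π i j A) (observations I f e π i j A) x
    - I.width * postSd I.k I.lam (queries I π i j A) x

/-- Upper confidence bound of a batch run with the set `A` of potential maximizers. -/
def ucbWith (i : ℕ+) (j : ℕ) (A : Finset 𝒳) (x : 𝒳) : ℝ :=
  postMean I.k I.lam (queries I π i j A) (observations I f e π i j A) x
    + I.width * postSd I.k I.lam (queries I π i j A) x

open Classical in
/-- The set `𝒳_j⁽ⁱ⁾` of potential maximizers (batches are numbered from `1`; the value at `0`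
plays no role). -/
def potentialMaximizers [Fintype 𝒳] (i : ℕ+) : ℕ → Finset 𝒳
  | 0 => Finset.univ
  | 1 => Finset.univ
  | j + 2 => {x ∈ potentialMaximizers i (j + 1) |
      ∀ x' ∈ potentialMaximizers i (j + 1),
        lcbWith I f e π i (j + 1) (potentialMaximizers i (j + 1)) x' ≤
          ucbWith I f e π i (j + 1) (potentialMaximizers i (j + 1)) x}

/-- `lcb_j⁽ⁱ⁾(x)` when the algorithm is run on the reward functions `f`, the noise realization `e`
and the permutations `π`. -/
def lcb [Fintype 𝒳] (i : ℕ+) (j : ℕ) (x : 𝒳) : ℝ :=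
  lcbWith I f e π i j (potentialMaximizers I f e π i j) x

/-- `ucb_j⁽ⁱ⁾(x)` when the algorithm is run on the reward functions `f`, the noise realization `e`
and the permutations `π`. -/
def ucb [Fintype 𝒳] (i : ℕ+) (j : ℕ) (x : 𝒳) : ℝ :=
  ucbWith I f e π i j (potentialMaximizers I f e π i j) x

end Algorithm

/-- The average `f̄_j⁽ⁱ⁾` of the reward functions over the `j`-th batch of the `i`-th interval. -/
def avgReward {𝒳 : Type*} (T H : ℕ) (f : ℕ+ → 𝒳 → ℝ) (i : ℕ+) (j : ℕ) (x : 𝒳) : ℝ :=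
  (∑ m : Fin (size T H i j), f (time T H i j m) x) / (size T H i j : ℝ)

/-! ### Randomness -/

section Random

variable {Ω : Type*} [MeasurableSpace Ω]

/-- Mutually independent, `ρ`-sub-Gaussian noise variables:
`𝔼[exp (η ε_t)] ≤ exp (η² ρ² / 2)` for all `η`. -/
structure IsNoise (P : Measure Ω) (ρ : ℝ≥0) (ε : ℕ+ → Ω → ℝ) : Prop where
  measurable : ∀ t, Measurable (ε t)
  indep : iIndepFun ε P
  subgaussian : ∀ t, HasSubgaussianMGF (ε t) (ρ ^ 2) P

/-- Permutations of a finite set carry the discrete σ-algebra. -/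
instance (n : ℕ) : MeasurableSpace (Equiv.Perm (Fin n)) := ⊤

/-- Mutually independent, uniformly distributed permutations, one for each batch. -/
structure IsUniformPerms (P : Measure Ω) (T H : ℕ)
    (ψ : ∀ (i : ℕ+) (j : ℕ), Ω → Equiv.Perm (Fin (size T H i j))) : Prop where
  measurable : ∀ i j, Measurable (ψ i j)
  indep : iIndepFun (fun (p : ℕ+ × ℕ) => ψ p.1 p.2) P
  uniform : ∀ i j, P.map (ψ i j) = uniformOn Set.univ

end Random

end

end RPERP

/-!
Fix a batch and run it with a fixed set of potential maximizers. The candidates `s_a` are then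
deterministic, and with the posterior weights `w = (K + λ)⁻¹ k(x)` at the candidates the posterior
mean is `∑ m, w (π m) * (f_m (s (π m)) + ε_m)` for the random permutation `π`. Its expectation is
`∑ a, w a * f̄ (s a)`, where `f̄` is the average reward function, and its deviation from `f̄ x` is
the inner product of `f̄` with the residual of kernel ridge regression. The identity
`σ² = ‖φ x - ∑ a, w a • φ (s a)‖² + λ ‖w‖²` (`RPERP.postVar_eq_norm_sq_add`) bounds that bias by
`B σ` and gives `‖w‖ ≤ σ / √λ`.

The fluctuation around the expectation is sub-Gaussian with parameter `((4 B + ρ) ‖w‖)²`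
(`hasSubgaussianMGF_permuted_sum`): the noise contributes `ρ ‖w‖`, and Hoeffding's combinatorial
statistic `∑ m, G m (π m)` of a matrix with `|G m a| ≤ c a` has exponential moments bounded by
`exp (8 ∑ c²)` (`sum_perm_exp_le`). For the latter the positions of the columns are revealed one
after the other in decreasing order of `c`, so that the step that reveals column `a` changes the
conditional mean by at most a multiple of `c a`.

The set of potential maximizers is random, but it depends only on the noise and the permutations of
earlier batches of the same interval, which are independent of those of the current batch
(`RPERP.measurableSet_potentialMaximizers`, `RPERP.iIndep_sourceSpace`), so that the failure
probability `2 exp (-ln (4 |𝒳| Q_{T,H} / δ))` of one batch and one input is unaffected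
(`measure_mem_random_le_of_indep`). The batch sizes satisfy `N_j ≥ L ^ (1 - 2 ^ (-j))` until an
interval of length `L` is used up, so at most `1 + log₂ log₂ H` batches of an interval have
confidence bounds (`RPERP.numBatches_sub_one_le`), and a union bound concludes.
-/

/-! ### Hoeffding's combinatorial statistic -/

/-- Hoeffding's lemma for the uniform distribution on a finite set. -/
theorem sum_exp_sub_mean_le {ι : Type*} [Fintype ι] (u : ι → ℝ) (R : ℝ) (hu : ∀ i, |u i| ≤ R) :
    ∑ i, Real.exp (u i - (∑ j, u j) / Fintype.card ι) ≤
      Fintype.card ι * Real.exp (2 * R ^ 2) := by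
  rcases isEmpty_or_nonempty ι with h | ⟨⟨i₀⟩⟩
  · simp
  have hR : 0 ≤ R := (abs_nonneg _).trans (hu i₀)
  have hn : (0 : ℝ) < Fintype.card ι := by
    exact_mod_cast Fintype.card_pos_iff.mpr ⟨i₀⟩
  set m := (∑ j, u j) / Fintype.card ι with hm
  have hmR : |m| ≤ R := by
    rw [hm, abs_div, abs_of_pos hn, div_le_iff₀ hn]
    calc |∑ j, u j| ≤ ∑ j, |u j| := Finset.abs_sum_le_sum_abs _ _
      _ ≤ ∑ _j : ι, R := Finset.sum_le_sum fun j _ => hu j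
      _ = R * Fintype.card ι := by simp [mul_comm]
  have hd : ∀ i, |u i - m| ≤ 2 * R := fun i => by
    have := abs_sub (u i) m
    linarith [hu i]
  have hsum : ∑ i, (u i - m) = 0 := by
    rw [Finset.sum_sub_distrib, hm]
    simp only [Finset.sum_const, Finset.card_univ, nsmul_eq_mul]
    field_simp
    ring
  rcases hR.eq_or_lt with h0 | hpos
  · have : ∀ i, u i - m = 0 := fun i => by
      have := hd i
      rw [← h0, mul_zero] at this
      exact abs_nonpos_iff.mp this
    simp [this, ← h0]
  have hb : ∀ i, Real.exp (u i - m) ≤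
      Real.cosh (2 * R) + (u i - m) / (2 * R) * Real.sinh (2 * R) := fun i => by
    have h1 : |(u i - m) / (2 * R)| ≤ 1 := by
      rw [abs_div, abs_of_pos (by positivity : (0 : ℝ) < 2 * R)]
      exact (div_le_one (by positivity)).mpr (hd i)
    have := Real.exp_mul_le_cosh_add_mul_sinh h1 (2 * R)
    rwa [div_mul_cancel₀ _ (by positivity)] at this
  calc ∑ i, Real.exp (u i - m)
      ≤ ∑ i, (Real.cosh (2 * R) + (u i - m) / (2 * R) * Real.sinh (2 * R)) :=
        Finset.sum_le_sum fun i _ => hb i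
    _ = Fintype.card ι * Real.cosh (2 * R) := by
        rw [Finset.sum_add_distrib, ← Finset.sum_mul, ← Finset.sum_div, hsum]
        simp
    _ ≤ Fintype.card ι * Real.exp (2 * R ^ 2) := by
        gcongr
        refine (Real.cosh_le_exp_half_sq _).trans_eq ?_
        congr 1
        ring

/-- The induction step reveals `σ 0`. Given `σ 0 = p`, the conditional mean of the sum is, up to a
constant, `g 0 p` minus an average of the entries `g a p` with `a > 0`; all of these are bounded by
`c 0` because `c` is antitone, so Hoeffding's lemma bounds the contribution of this step. -/
theorem sum_perm_exp_le_of_antitone : ∀ (n : ℕ) (g : Fin n → Fin n → ℝ) (c : Fin n → ℝ),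
    Antitone c → (∀ a m, |g a m| ≤ c a) →
    ∑ σ : Equiv.Perm (Fin n), Real.exp (∑ a, g a (σ a) - (∑ a, ∑ m, g a m) / n) ≤
      n.factorial * Real.exp (8 * ∑ a, c a ^ 2)
  | 0, _, _, _, _ => by simp
  | n + 1, g, c, hc, hg => by
    set T : ℝ := (∑ a, ∑ m, g a m) / ((n + 1 : ℕ) : ℝ) with hT
    let g' : Fin (n + 1) → Fin n → Fin n → ℝ := fun p a m => g a.succ (Equiv.swap 0 p m.succ)
    let u : Fin (n + 1) → ℝ := fun p => g 0 p - (∑ a : Fin n, g a.succ p) / n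
    have hrow : ∀ (p : Fin (n + 1)) (a : Fin n),
        ∑ m, g' p a m = ∑ q, g a.succ q - g a.succ p := fun p a => by
      rw [← Equiv.sum_comp (Equiv.swap 0 p) (fun q => g a.succ q), Fin.sum_univ_succ]
      simp [g']
    have hD : ∀ p, g 0 p + (∑ a, ∑ m, g' p a m) / n - T =
        u p - (∑ q, u q) / Fintype.card (Fin (n + 1)) := fun p => by
      simp only [hrow, u, hT, Fintype.card_fin]
      rw [Fin.sum_univ_succ (fun a => ∑ m, g a m), Finset.sum_sub_distrib,
        Finset.sum_sub_distrib, ← Finset.sum_div,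
        Finset.sum_comm (f := fun q (a : Fin n) => g a.succ q)]
      rcases Nat.eq_zero_or_pos n with h0 | h0
      · subst h0; simp
      · have : (n : ℝ) ≠ 0 := by positivity
        push_cast
        field_simp
        ring
    have hu : ∀ p, |u p| ≤ 2 * c 0 := fun p => by
      have h1 : |(∑ a : Fin n, g a.succ p) / n| ≤ c 0 := by
        rcases Nat.eq_zero_or_pos n with h0 | h0
        · subst h0
          simpa using (abs_nonneg _).trans (hg 0 0)
        · have hn : (0 : ℝ) < n := by positivity
          rw [abs_div, abs_of_pos hn, div_le_iff₀ hn]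
          calc |∑ a : Fin n, g a.succ p| ≤ ∑ a : Fin n, |g a.succ p| :=
                Finset.abs_sum_le_sum_abs _ _
            _ ≤ ∑ _a : Fin n, c 0 :=
                Finset.sum_le_sum fun a _ => (hg _ _).trans (hc (Fin.zero_le _))
            _ = c 0 * n := by simp [mul_comm]
      have := abs_sub (g 0 p) ((∑ a : Fin n, g a.succ p) / n)
      have h2 := hg 0 p
      simp only [u]
      linarith
    have ih : ∀ p, ∑ τ : Equiv.Perm (Fin n),
        Real.exp (∑ a, g' p a (τ a) - (∑ a, ∑ m, g' p a m) / n) ≤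
          n.factorial * Real.exp (8 * ∑ a : Fin n, c a.succ ^ 2) := fun p =>
      sum_perm_exp_le_of_antitone n (g' p) (fun a => c a.succ)
        (fun a b hab => hc (Fin.succ_le_succ_iff.mpr hab)) (fun a m => hg _ _)
    rw [← Equiv.sum_comp Equiv.Perm.decomposeFin.symm, Fintype.sum_prod_type]
    calc ∑ p : Fin (n + 1), ∑ τ : Equiv.Perm (Fin n),
          Real.exp (∑ a, g a (Equiv.Perm.decomposeFin.symm (p, τ) a) - T)
        = ∑ p : Fin (n + 1), Real.exp (u p - (∑ q, u q) / Fintype.card (Fin (n + 1))) *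
            ∑ τ : Equiv.Perm (Fin n),
              Real.exp (∑ a, g' p a (τ a) - (∑ a, ∑ m, g' p a m) / n) := by
          refine Finset.sum_congr rfl fun p _ => ?_
          rw [Finset.mul_sum]
          refine Finset.sum_congr rfl fun τ _ => ?_
          rw [← Real.exp_add, ← hD, Fin.sum_univ_succ]
          simp only [Equiv.Perm.decomposeFin_symm_apply_zero,
            Equiv.Perm.decomposeFin_symm_apply_succ, g']
          congr 1
          ring
      _ ≤ ∑ p : Fin (n + 1), Real.exp (u p - (∑ q, u q) / Fintype.card (Fin (n + 1))) *
            (n.factorial * Real.exp (8 * ∑ a : Fin n, c a.succ ^ 2)) := by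
          gcongr with p _
          exact ih p
      _ ≤ (Fintype.card (Fin (n + 1)) * Real.exp (2 * (2 * c 0) ^ 2)) *
            (n.factorial * Real.exp (8 * ∑ a : Fin n, c a.succ ^ 2)) := by
          rw [← Finset.sum_mul]
          gcongr
          exact sum_exp_sub_mean_le u _ hu
      _ = (n + 1).factorial * Real.exp (8 * ∑ a, c a ^ 2) := by
          rw [Fin.sum_univ_succ, mul_add, Real.exp_add, Nat.factorial_succ, Fintype.card_fin]
          push_cast
          rw [show 2 * (2 * c 0) ^ 2 = 8 * c 0 ^ 2 by ring]
          ring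

/-- Exponential moment bound for Hoeffding's combinatorial statistic `∑ m, G m (π m)` under a
uniformly random permutation `π`, with the bound on the entries depending on the column. -/
theorem sum_perm_exp_le {n : ℕ} (G : Fin n → Fin n → ℝ) (c : Fin n → ℝ)
    (hG : ∀ m a, |G m a| ≤ c a) :
    ∑ π : Equiv.Perm (Fin n), Real.exp (∑ m, G m (π m) - (∑ a, ∑ m, G m a) / n) ≤
      n.factorial * Real.exp (8 * ∑ a, c a ^ 2) := by
  set s := Tuple.sort (fun a => -c a) with hs
  have hanti : Antitone (fun a => c (s a)) := fun a b hab => by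
    have := Tuple.monotone_sort (fun a => -c a) hab
    simpa using this
  have h := sum_perm_exp_le_of_antitone n (fun a m => G m (s a)) (fun a => c (s a)) hanti
    (fun a m => hG m (s a))
  rw [Equiv.sum_comp s (fun a => c a ^ 2), Equiv.sum_comp s (fun a => ∑ m, G m a)] at h
  refine le_of_eq_of_le ?_ h
  refine Fintype.sum_equiv ((Equiv.inv _).trans (Equiv.mulRight s)) _ _ fun π => ?_
  congr 2
  rw [← Equiv.sum_comp (s.trans π⁻¹) (fun m => G m (π m))]
  simp

/-! ### Posterior weights and kernel ridge regression -/

namespace RPERP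

/-- The coefficients `(K(X, X) + λ I)⁻¹ k(x, X)` of the posterior mean at `x` in the
observations. -/
noncomputable def postWeights {𝒳 : Type*} (k : 𝒳 → 𝒳 → ℝ) (lam : ℝ) {n : ℕ} (X : Fin n → 𝒳)
    (x : 𝒳) : Fin n → ℝ :=
  (kernelMat k X + lam • (1 : Matrix (Fin n) (Fin n) ℝ))⁻¹ *ᵥ kernelVec k X x

section Posterior

variable {𝒳 : Type*} {k : 𝒳 → 𝒳 → ℝ} {lam : ℝ} {n : ℕ}

theorem postVar_eq_sub_dotProduct (X : Fin n → 𝒳) (x : 𝒳) :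
    postVar k lam X x = k x x - kernelVec k X x ⬝ᵥ postWeights k lam X x := rfl

theorem postMean_eq_dotProduct (hk : ∀ x y, k x y = k y x) (X : Fin n → 𝒳) (y : Fin n → ℝ)
    (x : 𝒳) : postMean k lam X y x = postWeights k lam X x ⬝ᵥ y := by
  have hsymm : (kernelMat k X + lam • (1 : Matrix (Fin n) (Fin n) ℝ))ᵀ =
      kernelMat k X + lam • (1 : Matrix (Fin n) (Fin n) ℝ) := by
    ext a b
    simp [kernelMat, hk (X a) (X b), Matrix.one_apply, eq_comm]
  rw [postMean, postWeights, Matrix.dotProduct_mulVec, ← Matrix.mulVec_transpose,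
    Matrix.transpose_nonsing_inv, hsymm]

theorem postWeights_comp_perm (X : Fin n → 𝒳) (π : Equiv.Perm (Fin n)) (x : 𝒳) :
    postWeights k lam (fun m => X (π m)) x = fun m => postWeights k lam X x (π m) := by
  have h1 : kernelMat k (fun m => X (π m)) + lam • (1 : Matrix (Fin n) (Fin n) ℝ) =
      (kernelMat k X + lam • (1 : Matrix (Fin n) (Fin n) ℝ)).submatrix π π := by
    ext a b
    simp [kernelMat, Matrix.one_apply]
  have h2 : kernelVec k (fun m => X (π m)) x = kernelVec k X x ∘ π := rfl
  rw [postWeights, h1, h2, Matrix.inv_submatrix_equiv, Matrix.submatrix_mulVec_equiv]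
  funext m
  simp [postWeights, Function.comp_assoc]

theorem postSd_comp_perm (X : Fin n → 𝒳) (π : Equiv.Perm (Fin n)) (x : 𝒳) :
    postSd k lam (fun m => X (π m)) x = postSd k lam X x := by
  rw [postSd, postSd, postVar_eq_sub_dotProduct, postVar_eq_sub_dotProduct,
    postWeights_comp_perm]
  congr 2
  exact Equiv.sum_comp π (fun a => kernelVec k X x a * postWeights k lam X x a)

variable {E : Type*} [NormedAddCommGroup E] [InnerProductSpace ℝ E] {φ : 𝒳 → E}

theorem kernelMat_mulVec_postWeights (hφ : ∀ x y, inner ℝ (φ x) (φ y) = k x y) (hlam : 0 < lam)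
    (X : Fin n → 𝒳) (x : 𝒳) :
    kernelMat k X *ᵥ postWeights k lam X x + lam • postWeights k lam X x = kernelVec k X x := by
  have hgram : kernelMat k X = Matrix.gram ℝ (fun a => φ (X a)) := by
    ext a b
    simp [kernelMat, Matrix.gram_apply, hφ]
  have hpd : (kernelMat k X + lam • (1 : Matrix (Fin n) (Fin n) ℝ)).PosDef := by
    rw [hgram]
    exact Matrix.PosDef.posSemidef_add (Matrix.posSemidef_gram ℝ _)
      (Matrix.PosDef.one.smul hlam)
  have hdet : IsUnit (kernelMat k X + lam • (1 : Matrix (Fin n) (Fin n) ℝ)).det :=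
    hpd.det_pos.ne'.isUnit
  calc kernelMat k X *ᵥ postWeights k lam X x + lam • postWeights k lam X x
      = (kernelMat k X + lam • (1 : Matrix (Fin n) (Fin n) ℝ)) *ᵥ postWeights k lam X x := by
        rw [Matrix.add_mulVec, Matrix.smul_mulVec, Matrix.one_mulVec]
    _ = kernelVec k X x := by
        rw [postWeights, Matrix.mulVec_mulVec, Matrix.mul_nonsing_inv _ hdet, Matrix.one_mulVec]

/-- The posterior variance is the minimum of the kernel ridge regression functional, attained at
the posterior weights. -/
theorem postVar_eq_norm_sq_add (hφ : ∀ x y, inner ℝ (φ x) (φ y) = k x y) (hlam : 0 < lam)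
    (X : Fin n → 𝒳) (x : 𝒳) :
    postVar k lam X x = ‖φ x - ∑ a, postWeights k lam X x a • φ (X a)‖ ^ 2 +
      lam * ∑ a, postWeights k lam X x a ^ 2 := by
  set w := postWeights k lam X x with hw
  have h1 : inner ℝ (φ x) (∑ a, w a • φ (X a)) = kernelVec k X x ⬝ᵥ w := by
    simp [inner_sum, inner_smul_right, hφ, kernelVec, dotProduct, mul_comm]
  have h2 : ‖∑ a, w a • φ (X a)‖ ^ 2 = w ⬝ᵥ (kernelMat k X *ᵥ w) := by
    rw [← real_inner_self_eq_norm_sq, sum_inner]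
    refine Finset.sum_congr rfl fun a _ => ?_
    rw [inner_smul_left, inner_sum]
    simp [inner_smul_right, hφ, kernelMat, Matrix.mulVec, dotProduct, mul_comm]
  have h3 : kernelMat k X *ᵥ w = kernelVec k X x - lam • w :=
    eq_sub_of_add_eq (kernelMat_mulVec_postWeights hφ hlam X x)
  have h4 : w ⬝ᵥ w = ∑ a, w a ^ 2 := Finset.sum_congr rfl fun a _ => (sq _).symm
  rw [norm_sub_sq_real, h1, h2, h3, dotProduct_sub, dotProduct_smul, h4, smul_eq_mul,
    dotProduct_comm w, real_inner_self_eq_norm_sq (φ x) |>.symm, hφ, postVar_eq_sub_dotProduct]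
  ring

theorem norm_sub_sum_postWeights_le_postSd (hφ : ∀ x y, inner ℝ (φ x) (φ y) = k x y)
    (hlam : 0 < lam) (X : Fin n → 𝒳) (x : 𝒳) :
    ‖φ x - ∑ a, postWeights k lam X x a • φ (X a)‖ ≤ postSd k lam X x := by
  refine Real.le_sqrt_of_sq_le ?_
  rw [postVar_eq_norm_sq_add hφ hlam]
  have : 0 ≤ lam * ∑ a, postWeights k lam X x a ^ 2 := by positivity
  linarith

theorem sqrt_sum_postWeights_sq_le (hφ : ∀ x y, inner ℝ (φ x) (φ y) = k x y)
    (hlam : 0 < lam) (X : Fin n → 𝒳) (x : 𝒳) :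
    √(∑ a, postWeights k lam X x a ^ 2) ≤ postSd k lam X x / √lam := by
  rw [le_div_iff₀ (Real.sqrt_pos.mpr hlam), ← Real.sqrt_mul (by positivity)]
  refine Real.sqrt_le_sqrt ?_
  rw [postVar_eq_norm_sq_add hφ hlam, mul_comm]
  have := sq_nonneg ‖φ x - ∑ a, postWeights k lam X x a • φ (X a)‖
  linarith

end Posterior
end RPERP

/-! ### Number of batches -/

namespace RPERP

theorem sum_batchSize_le (L j : ℕ) : ∑ l ∈ Finset.Icc 1 j, batchSize L l ≤ L := by
  induction j with
  | zero => simp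
  | succ j ih =>
    rw [Finset.sum_Icc_succ_top (by omega), batchSize_succ]
    omega

/-- As long as the interval is not used up, the batch sizes grow as the recursion without
truncation would make them: `N_j ≥ L ^ (1 - 2 ^ (-j))`, written with the logarithm to base `2`. -/
theorem two_rpow_le_batchSize {L : ℕ} (hL : 0 < L) : ∀ j : ℕ,
    ∑ l ∈ Finset.Icc 1 j, batchSize L l ≠ L →
    (2 : ℝ) ^ (Real.logb 2 L * (1 - (2 : ℝ)⁻¹ ^ j)) ≤ batchSize L j := by
  have hL' : (0 : ℝ) < L := by exact_mod_cast hL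
  have hLpow : (2 : ℝ) ^ Real.logb 2 L = L := Real.rpow_logb (by norm_num) (by norm_num) hL'
  intro j
  induction j with
  | zero => intro _; simp [batchSize]
  | succ j ih =>
    intro hne
    have hs : ∑ l ∈ Finset.Icc 1 (j + 1), batchSize L l =
        ∑ l ∈ Finset.Icc 1 j, batchSize L l + batchSize L (j + 1) :=
      Finset.sum_Icc_succ_top (by omega) _
    have hb := batchSize_succ L j
    have hle := sum_batchSize_le L (j + 1)
    have hle' := sum_batchSize_le L j
    have hceil : batchSize L (j + 1) = ⌈√((L : ℝ) * (batchSize L j : ℝ))⌉₊ := by omega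
    have hprev : ∑ l ∈ Finset.Icc 1 j, batchSize L l ≠ L := by omega
    rw [hceil]
    refine le_trans ?_ (Nat.le_ceil _)
    refine Real.le_sqrt_of_sq_le ?_
    calc ((2 : ℝ) ^ (Real.logb 2 L * (1 - (2 : ℝ)⁻¹ ^ (j + 1)))) ^ 2
        = (2 : ℝ) ^ (Real.logb 2 L) * (2 : ℝ) ^ (Real.logb 2 L * (1 - (2 : ℝ)⁻¹ ^ j)) := by
          rw [← Real.rpow_natCast, ← Real.rpow_mul (by norm_num), ← Real.rpow_add (by norm_num)]
          congr 1
          push_cast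
          ring
      _ ≤ L * batchSize L j := by
          rw [hLpow]
          gcongr
          exact ih hprev

/-- For `J ≥ log₂ log₂ L`, the batches `J` and `J + 1` would both have at least `L / 2` elements
if the interval were not used up after batch `J + 1`, a contradiction. -/
theorem numBatches_le_succ {L : ℕ} (hL : 2 ≤ L) {J : ℕ}
    (hJ : Real.logb 2 (Real.logb 2 L) ≤ J) : numBatches L ≤ J + 1 := by
  rw [numBatches]
  refine Nat.find_min' _ ?_
  by_contra hne
  have hL0 : 0 < L := by omega
  have hL' : (0 : ℝ) < L := by exact_mod_cast hL0
  have hL2 : (2 : ℝ) ≤ L := by exact_mod_cast hL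
  have hlog : 1 ≤ Real.logb 2 L := by
    rw [Real.le_logb_iff_rpow_le (by norm_num) hL']
    simpa using hL2
  have hpow : Real.logb 2 L ≤ (2 : ℝ) ^ J := by
    have := (Real.logb_le_iff_le_rpow (b := 2) (by norm_num) (by linarith)).mp hJ
    simpa using this
  have key : ∀ j, J ≤ j → ∑ l ∈ Finset.Icc 1 j, batchSize L l ≠ L →
      (L : ℝ) / 2 ≤ batchSize L j := fun j hj hsum => by
    refine le_trans ?_ (two_rpow_le_batchSize hL0 j hsum)
    have hq : Real.logb 2 L * (2 : ℝ)⁻¹ ^ j ≤ 1 := by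
      rw [inv_pow, ← div_eq_mul_inv, div_le_one (by positivity)]
      exact hpow.trans (pow_le_pow_right₀ (by norm_num) hj)
    calc (L : ℝ) / 2 = (2 : ℝ) ^ (Real.logb 2 L - 1) := by
          rw [Real.rpow_sub (by norm_num), Real.rpow_logb (by norm_num) (by norm_num) hL',
            Real.rpow_one]
      _ ≤ _ := by
          refine Real.rpow_le_rpow_of_exponent_le (by norm_num) ?_
          linarith
  have hs : ∑ l ∈ Finset.Icc 1 (J + 1), batchSize L l =
      ∑ l ∈ Finset.Icc 1 J, batchSize L l + batchSize L (J + 1) :=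
    Finset.sum_Icc_succ_top (by omega) _
  have hle := sum_batchSize_le L (J + 1)
  have hle' := sum_batchSize_le L J
  have hb := batchSize_succ L J
  have hJne : ∑ l ∈ Finset.Icc 1 J, batchSize L l ≠ L := by omega
  have h1 := key J le_rfl hJne
  have h2 := key (J + 1) (by omega) hne
  rcases Nat.eq_zero_or_pos J with h0 | h0
  · -- here `log₂ L ≤ 1`, so `L = 2`, and the first batch has `⌈√2⌉ = 2` elements
    subst h0
    have hb0 : batchSize L 0 = 1 := by simp [batchSize]
    have hL2' : (L : ℝ) ≤ 2 := by
      rw [hb0] at h1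
      push_cast at h1
      linarith
    have hLeq : L = 2 := le_antisymm (by exact_mod_cast hL2') hL
    have hc : 1 < ⌈√((L : ℝ) * (batchSize L 0 : ℝ))⌉₊ := by
      rw [Nat.lt_ceil, hb0, hLeq]
      exact Real.lt_sqrt_of_sq_lt (by norm_num)
    have h00 : ∑ l ∈ Finset.Icc 1 0, batchSize L l = 0 := by simp
    omega
  · have hsplit : ∑ l ∈ Finset.Icc 1 J, batchSize L l =
        ∑ l ∈ Finset.Icc 1 (J - 1), batchSize L l + batchSize L J := by
      obtain ⟨j, rfl⟩ : ∃ j, J = j + 1 := ⟨J - 1, by omega⟩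
      exact Finset.sum_Icc_succ_top (by omega) _
    have h3 : (batchSize L J : ℝ) + batchSize L (J + 1) ≤ L := by
      exact_mod_cast (by omega : batchSize L J + batchSize L (J + 1) ≤ L)
    have h4 : batchSize L J + batchSize L (J + 1) = L := by
      have : (L : ℝ) ≤ batchSize L J + batchSize L (J + 1) := by linarith
      exact le_antisymm (by exact_mod_cast h3) (by exact_mod_cast this)
    omega

/-- The number of batches whose confidence bounds are used is at most `1 + log₂ log₂ H`. -/
theorem numBatches_sub_one_le {L H : ℕ} (hH : 2 ≤ H) (hLH : L ≤ H) :
    ((numBatches L - 1 : ℕ) : ℝ) ≤ 1 + Real.logb 2 (Real.logb 2 H) := by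
  have hH2 : (2 : ℝ) ≤ H := by exact_mod_cast hH
  have hlogH : 1 ≤ Real.logb 2 H := by
    rw [Real.le_logb_iff_rpow_le (by norm_num) (by linarith)]
    simpa using hH2
  have hnn : 0 ≤ Real.logb 2 (Real.logb 2 H) := Real.logb_nonneg (by norm_num) hlogH
  rcases lt_or_ge L 2 with hL | hL
  · have : numBatches L ≤ 1 := by
      rw [numBatches]
      refine Nat.find_min' _ ?_
      have hb := batchSize_succ L 0
      have hb0 : batchSize L 0 = 1 := by simp [batchSize]
      rw [hb0] at hb
      interval_cases L <;> simp_all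
    rw [Nat.sub_eq_zero_of_le this]
    push_cast
    linarith
  · have hL2 : (2 : ℝ) ≤ L := by exact_mod_cast hL
    have hlogL : 1 ≤ Real.logb 2 L := by
      rw [Real.le_logb_iff_rpow_le (by norm_num) (by linarith)]
      simpa using hL2
    have hmono : Real.logb 2 (Real.logb 2 L) ≤ Real.logb 2 (Real.logb 2 H) :=
      Real.logb_le_logb_of_le (by norm_num) (by linarith)
        (Real.logb_le_logb_of_le (by norm_num) (by linarith) (by exact_mod_cast hLH))
    have h := numBatches_le_succ hL (Nat.le_ceil (Real.logb 2 (Real.logb 2 L)))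
    have h' : ((numBatches L - 1 : ℕ) : ℝ) ≤ ⌈Real.logb 2 (Real.logb 2 L)⌉₊ := by
      exact_mod_cast (by omega : numBatches L - 1 ≤ ⌈Real.logb 2 (Real.logb 2 L)⌉₊)
    have := Nat.ceil_lt_add_one (Real.logb_nonneg (by norm_num : (1 : ℝ) < 2) hlogL)
    linarith

end RPERP

/-! ### Sub-Gaussian tails and independence -/

section Concentration

variable {Ω : Type*} [MeasurableSpace Ω] {P : Measure Ω}

/-- The statement is strict in order to cover `c = 0`, where `Z` vanishes almost surely. -/
theorem measure_lt_le_exp_neg [IsProbabilityMeasure P] {Z : Ω → ℝ} {c : ℝ≥0}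
    (hZ : HasSubgaussianMGF Z c P) {L : ℝ} (hL : 0 ≤ L) :
    P {ω | √c * √(2 * L) < Z ω} ≤ ENNReal.ofReal (Real.exp (-L)) := by
  rcases eq_or_ne c 0 with rfl | hc
  · have h0 : P {ω | √((0 : ℝ≥0) : ℝ) * √(2 * L) < Z ω} = 0 := by
      refine measure_mono_null (fun ω hω => ?_) (ae_iff.mp hZ.ae_eq_zero_of_hasSubgaussianMGF_zero)
      simp only [NNReal.coe_zero, Real.sqrt_zero, zero_mul, Set.mem_ofPred_eq] at hω
      exact hω.ne'
    rw [h0]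
    exact zero_le
  · have hc' : (0 : ℝ) < c := by exact_mod_cast pos_iff_ne_zero.mpr hc
    have h := hZ.measure_ge_le (ε := √c * √(2 * L)) (by positivity)
    rw [mul_pow, Real.sq_sqrt hc'.le, Real.sq_sqrt (by positivity),
      show -((c : ℝ) * (2 * L)) / (2 * c) = -L by field_simp] at h
    calc P {ω | √c * √(2 * L) < Z ω} ≤ P {ω | √c * √(2 * L) ≤ Z ω} :=
          measure_mono (Set.ofPred_subset_ofPred.mpr fun ω hω => le_of_lt hω)
      _ = ENNReal.ofReal (P.real {ω | √c * √(2 * L) ≤ Z ω}) := (ofReal_measureReal).symm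
      _ ≤ _ := ENNReal.ofReal_le_ofReal h

theorem measure_lt_abs_le_exp_neg [IsProbabilityMeasure P] {Z : Ω → ℝ} {c : ℝ≥0}
    (hZ : HasSubgaussianMGF Z c P) {L : ℝ} (hL : 0 ≤ L) :
    P {ω | √c * √(2 * L) < |Z ω|} ≤ ENNReal.ofReal (2 * Real.exp (-L)) := by
  calc P {ω | √c * √(2 * L) < |Z ω|}
      ≤ P ({ω | √c * √(2 * L) < Z ω} ∪ {ω | √c * √(2 * L) < (-Z) ω}) :=
        measure_mono fun ω hω => by simpa [lt_abs] using hω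
    _ ≤ _ := (measure_union_le _ _).trans
        (add_le_add (measure_lt_le_exp_neg hZ hL) (measure_lt_le_exp_neg hZ.neg hL))
    _ = _ := by rw [← ENNReal.ofReal_add (by positivity) (by positivity), two_mul]

/-- Decomposing according to the value `π` of the permutation separates the noise, which by
independence contributes the factor `exp (ρ² ‖w‖² t² / 2)` whatever `π` is, from Hoeffding's
combinatorial statistic of the matrix `w a * h m a`. -/
theorem hasSubgaussianMGF_permuted_sum [IsProbabilityMeasure P] {n : ℕ} (w : Fin n → ℝ)
    (h : Fin n → Fin n → ℝ) {B : ℝ} (hB : 0 ≤ B) (hh : ∀ m a, |h m a| ≤ B)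
    {π : Ω → Equiv.Perm (Fin n)} (hπ : ∀ p, MeasurableSet (π ⁻¹' {p}))
    (huni : ∀ p, P.real (π ⁻¹' {p}) = (n.factorial : ℝ)⁻¹)
    {ρ : ℝ≥0} {ξ : Fin n → Ω → ℝ} (hξ : iIndepFun ξ P)
    (hsub : ∀ m, HasSubgaussianMGF (ξ m) (ρ ^ 2) P)
    (hind : ∀ p (t : ℝ), IndepFun ((π ⁻¹' {p}).indicator (fun _ => (1 : ℝ)))
      (fun ω => Real.exp (t * ∑ m, w (p m) * ξ m ω)) P)
    {c : ℝ≥0} (hc : (c : ℝ) = (4 * B + ρ) ^ 2 * ∑ a, w a ^ 2) :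
    HasSubgaussianMGF (fun ω => ∑ m, w (π ω m) * (h m (π ω m) + ξ m ω) -
      ∑ a, w a * ((∑ m, h m a) / n)) c P := by
  classical
  set V : ℝ := ∑ a, w a ^ 2 with hV
  have hV0 : 0 ≤ V := by positivity
  let d : Equiv.Perm (Fin n) → ℝ := fun p =>
    ∑ m, w (p m) * h m (p m) - ∑ a, w a * ((∑ m, h m a) / n)
  let N : Equiv.Perm (Fin n) → Ω → ℝ := fun p ω => ∑ m, w (p m) * ξ m ω
  let v : ℝ≥0 := ρ ^ 2 * ∑ a, ‖w a‖₊ ^ 2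
  have hv : (v : ℝ) = ρ ^ 2 * V := by simp [v, hV]
  have hN : ∀ p, HasSubgaussianMGF (N p) v P := fun p => by
    have h1 := HasSubgaussianMGF.sum_of_iIndepFun (X := fun m ω => w (p m) * ξ m ω)
      (s := Finset.univ)
      (hξ.comp (fun m x => w (p m) * x) (fun m => by fun_prop))
      (fun m _ => (hsub m).const_mul (w (p m)))
    convert h1 using 1
    refine NNReal.coe_injective ?_
    rw [hv, hV, ← Equiv.sum_comp p, Finset.mul_sum, NNReal.coe_sum]
    exact Finset.sum_congr rfl fun m _ => mul_comm _ _
  have hpt : ∀ (t : ℝ) ω, Real.exp (t * (∑ m, w (π ω m) * (h m (π ω m) + ξ m ω) -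
      ∑ a, w a * ((∑ m, h m a) / n))) =
      ∑ p, (π ⁻¹' {p}).indicator (fun _ => (1 : ℝ)) ω *
        Real.exp (t * N p ω) * Real.exp (t * d p) := fun t ω => by
    rw [Finset.sum_eq_single (π ω)]
    · rw [Set.indicator_of_mem (by simp), one_mul, ← Real.exp_add]
      congr 1
      simp only [N, d, mul_add, Finset.sum_add_distrib]
      ring
    · intro p _ hp
      rw [Set.indicator_of_notMem (by simpa using hp.symm)]
      ring
    · simp
  have hint : ∀ p (t : ℝ), Integrable (fun ω => (π ⁻¹' {p}).indicator (fun _ => (1 : ℝ)) ω *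
      Real.exp (t * N p ω)) P := fun p t => by
    have := ((hN p).integrable_exp_mul t).indicator (hπ p)
    refine this.congr (ae_of_all _ fun ω => ?_)
    by_cases hω : ω ∈ π ⁻¹' {p} <;> simp [Set.indicator, hω]
  refine ⟨fun t => ?_, fun t => ?_⟩
  · simp only [hpt]
    exact integrable_finsetSum _ fun p _ => (hint p t).mul_const _
  · rw [mgf]
    simp only [hpt]
    rw [integral_finsetSum _ fun p _ => (hint p t).mul_const _]
    have hterm : ∀ p, ∫ ω, (π ⁻¹' {p}).indicator (fun _ => (1 : ℝ)) ω *
        Real.exp (t * N p ω) * Real.exp (t * d p) ∂P ≤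
        (n.factorial : ℝ)⁻¹ * Real.exp (v * t ^ 2 / 2) * Real.exp (t * d p) := fun p => by
      rw [integral_mul_const, (hind p t).integral_fun_mul_eq_mul_integral
        ((measurable_const.indicator (hπ p)).aestronglyMeasurable)
        ((hN p).integrable_exp_mul t).aestronglyMeasurable,
        integral_indicator_const _ (hπ p), huni p]
      gcongr
      · simp
      · exact (hN p).mgf_le t
    have hcomb := sum_perm_exp_le (fun m a => t * (w a * h m a)) (fun a => |t| * |w a| * B)
      (fun m a => by
        rw [abs_mul, abs_mul, ← mul_assoc]
        exact mul_le_mul_of_nonneg_left (hh m a) (by positivity))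
    have hsq : ∑ a, (|t| * |w a| * B) ^ 2 = t ^ 2 * B ^ 2 * V := by
      rw [hV, Finset.mul_sum]
      refine Finset.sum_congr rfl fun a _ => ?_
      rw [mul_pow, mul_pow, sq_abs, sq_abs]
      ring
    have hd : ∀ p : Equiv.Perm (Fin n), ∑ m, t * (w (p m) * h m (p m)) -
        (∑ a, ∑ m, t * (w a * h m a)) / n = t * d p := fun p => by
      simp only [d, ← Finset.mul_sum]
      rw [mul_sub, mul_div_assoc, Finset.sum_div]
      simp only [mul_div_assoc]
    simp only [hd, hsq] at hcomb
    calc _ ≤ ∑ p : Equiv.Perm (Fin n),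
          (n.factorial : ℝ)⁻¹ * Real.exp (v * t ^ 2 / 2) * Real.exp (t * d p) :=
          Finset.sum_le_sum fun p _ => hterm p
      _ = (n.factorial : ℝ)⁻¹ * Real.exp (v * t ^ 2 / 2) * ∑ p, Real.exp (t * d p) :=
          (Finset.mul_sum _ _ _).symm
      _ ≤ (n.factorial : ℝ)⁻¹ * Real.exp (v * t ^ 2 / 2) *
          (n.factorial * Real.exp (8 * (t ^ 2 * B ^ 2 * V))) := by gcongr
      _ = Real.exp (((4 * B) ^ 2 + ρ ^ 2) * V * t ^ 2 / 2) := by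
          have : (n.factorial : ℝ) ≠ 0 := by positivity
          rw [show ((4 * B) ^ 2 + (ρ : ℝ) ^ 2) * V * t ^ 2 / 2 =
            v * t ^ 2 / 2 + 8 * (t ^ 2 * B ^ 2 * V) by rw [hv]; ring, Real.exp_add]
          field_simp
      _ ≤ Real.exp (c * t ^ 2 / 2) := by
          rw [hc]
          gcongr
          have : 0 ≤ B * ρ := by positivity
          nlinarith

end Concentration

section Independence

variable {Ω : Type*} [mΩ : MeasurableSpace Ω] {P : Measure Ω}

theorem iIndep_sumElim {ι κ : Type*} {m₁ : ι → MeasurableSpace Ω} {m₂ : κ → MeasurableSpace Ω}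
    (h₁ : iIndep m₁ P) (h₂ : iIndep m₂ P) (h : Indep (⨆ i, m₁ i) (⨆ j, m₂ j) P) :
    iIndep (Sum.elim m₁ m₂) P := by
  rw [iIndep_iff]
  intro s f hf
  have hsplit : (⋂ i ∈ s, f i) =
      (⋂ i ∈ s.toLeft, f (Sum.inl i)) ∩ (⋂ j ∈ s.toRight, f (Sum.inr j)) := by
    ext ω
    simp
  have hl : ∀ i ∈ s.toLeft, MeasurableSet[m₁ i] (f (Sum.inl i)) := fun i hi =>
    hf _ (Finset.mem_toLeft.mp hi)
  have hr : ∀ j ∈ s.toRight, MeasurableSet[m₂ j] (f (Sum.inr j)) := fun j hj =>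
    hf _ (Finset.mem_toRight.mp hj)
  rw [hsplit, (Indep_iff _ _ _).mp h _ _
    (Finset.measurableSet_biInter _ fun i hi => le_iSup m₁ i _ (hl i hi))
    (Finset.measurableSet_biInter _ fun j hj => le_iSup m₂ j _ (hr j hj)),
    h₁.meas_biInter hl, h₂.meas_biInter hr]
  conv_rhs => rw [← Finset.toLeft_disjSum_toRight (u := s)]
  rw [Finset.prod_disjSum]

/-- A bound for each of finitely many events also holds for an event chosen at random
independently of them. -/
theorem measure_mem_random_le_of_indep [IsProbabilityMeasure P] {α : Type*} [Fintype α]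
    {m₁ m₂ : MeasurableSpace Ω} (hm₁ : m₁ ≤ mΩ) (hindep : Indep m₁ m₂ P) {A : Ω → α}
    (hA : ∀ a, MeasurableSet[m₁] (A ⁻¹' {a})) {S : α → Set Ω}
    (hS : ∀ a, MeasurableSet[m₂] (S a)) {c : ENNReal} (hc : ∀ a, P (S a) ≤ c) :
    P {ω | ω ∈ S (A ω)} ≤ c := by
  classical
  calc P {ω | ω ∈ S (A ω)} ≤ P (⋃ a ∈ Finset.univ, A ⁻¹' {a} ∩ S a) :=
        measure_mono fun ω hω => by simpa using hω
    _ ≤ ∑ a, P (A ⁻¹' {a} ∩ S a) := measure_biUnion_finset_le _ _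
    _ = ∑ a, P (A ⁻¹' {a}) * P (S a) :=
        Finset.sum_congr rfl fun a _ => (Indep_iff _ _ _).mp hindep _ _ (hA a) (hS a)
    _ ≤ ∑ a, P (A ⁻¹' {a}) * c := by gcongr with a; exact hc a
    _ = P (A ⁻¹' (Finset.univ : Finset α)) * c := by
        rw [← Finset.sum_mul, sum_measure_preimage_singleton _ fun a _ => hm₁ _ (hA a)]
    _ ≤ c := by simp

theorem measurable_eval_of_finite {Ω α : Type*} [Finite α] {m : MeasurableSpace Ω} {π : Ω → α}
    (hπ : ∀ a, MeasurableSet[m] (π ⁻¹' {a})) {F : α → Ω → ℝ} (hF : ∀ a, Measurable[m] (F a)) :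
    Measurable[m] (fun ω => F (π ω) ω) := by
  intro s hs
  have : (fun ω => F (π ω) ω) ⁻¹' s = ⋃ a, π ⁻¹' {a} ∩ F a ⁻¹' s := by
    ext ω
    simp
  rw [this]
  exact MeasurableSet.iUnion fun a => (hπ a).inter (hF a hs)

end Independence

/-! ### Confidence bounds of one batch -/

namespace RPERP

section Batch

variable {𝒳 : Type*} {I : Input 𝒳}

theorem postMean_queries_observations (hk : ∀ x y, I.k x y = I.k y x) (F : ℕ+ → 𝒳 → ℝ)
    (e : ℕ+ → ℝ) (π : Perms I.T I.H) (i : ℕ+) (j : ℕ) (A : Finset 𝒳) (x : 𝒳) :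
    postMean I.k I.lam (queries I π i j A) (observations I F e π i j A) x =
      ∑ m, postWeights I.k I.lam (candidates I i j A _) x (π i j m) *
        (F (time I.T I.H i j m) (candidates I i j A _ (π i j m)) + e (time I.T I.H i j m)) := by
  rw [postMean_eq_dotProduct hk]
  unfold queries
  rw [postWeights_comp_perm]
  rfl

theorem postSd_queries (π : Perms I.T I.H) (i : ℕ+) (j : ℕ) (A : Finset 𝒳) (x : 𝒳) :
    postSd I.k I.lam (queries I π i j A) x = postSd I.k I.lam (candidates I i j A (size I.T I.H i j)) x :=
  postSd_comp_perm _ _ _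

theorem time_injective (T H : ℕ) (i : ℕ+) (j : ℕ) : Function.Injective (time T H i j) := by
  intro m m' h
  have := Nat.succPNat_injective h
  exact Fin.ext (by omega)

theorem time_ne_of_lt {T H : ℕ} {i : ℕ+} {l j : ℕ} (hl : 1 ≤ l) (hlj : l < j)
    (m : Fin (size T H i l)) (m' : Fin (size T H i j)) : time T H i l m ≠ time T H i j m' := by
  intro h
  have h1 := Nat.succPNat_injective h
  have h2 : ∑ a ∈ Finset.Icc 1 l, size T H i a =
      ∑ a ∈ Finset.Icc 1 (l - 1), size T H i a + size T H i l := by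
    obtain ⟨b, rfl⟩ : ∃ b, l = b + 1 := ⟨l - 1, by omega⟩
    exact Finset.sum_Icc_succ_top (by omega) _
  have h3 : ∑ a ∈ Finset.Icc 1 l, size T H i a ≤ ∑ a ∈ Finset.Icc 1 (j - 1), size T H i a :=
    Finset.sum_le_sum_of_subset (Finset.Icc_subset_Icc le_rfl (by omega))
  have := m.2
  omega

variable {Ω : Type*} {ε : ℕ+ → Ω → ℝ}
  {ψ : ∀ (i : ℕ+) (j : ℕ), Ω → Equiv.Perm (Fin (size I.T I.H i j))}

theorem measurable_postMean_queries {m : MeasurableSpace Ω} (hk : ∀ x y, I.k x y = I.k y x)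
    (F : ℕ+ → 𝒳 → ℝ) {i : ℕ+} {j : ℕ} (hε : ∀ a, Measurable[m] (ε (time I.T I.H i j a)))
    (hψ : ∀ p, MeasurableSet[m] (ψ i j ⁻¹' {p})) (A : Finset 𝒳) (x : 𝒳) :
    Measurable[m] fun ω => postMean I.k I.lam (queries I (fun i j => ψ i j ω) i j A)
      (observations I F (fun t => ε t ω) (fun i j => ψ i j ω) i j A) x := by
  simp only [postMean_queries_observations hk]
  refine measurable_eval_of_finite hψ (F := fun p ω =>
    ∑ a, postWeights I.k I.lam (candidates I i j A _) x (p a) *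
      (F (time I.T I.H i j a) (candidates I i j A _ (p a)) + ε (time I.T I.H i j a) ω)) fun p => ?_
  fun_prop

variable {E : Type*} [NormedAddCommGroup E] [InnerProductSpace ℝ E] {φ : 𝒳 → E} {f : ℕ+ → E}
  {B : ℝ}

/-- The expectation of the posterior mean over the permutation differs from the average reward by
the inner product of the average reward function with the residual of the kernel ridge
regression. -/
theorem abs_sum_postWeights_mul_sub_avgReward_le (hφ : ∀ x y, inner ℝ (φ x) (φ y) = I.k x y)
    (hlam : 0 < I.lam) (hf : ∀ t, ‖f t‖ ≤ B) (i : ℕ+) (j : ℕ)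
    (S : Fin (size I.T I.H i j) → 𝒳) (x : 𝒳) :
    |∑ a, postWeights I.k I.lam S x a *
        ((∑ m, inner ℝ (φ (S a)) (f (time I.T I.H i j m))) / (size I.T I.H i j : ℝ)) -
      avgReward I.T I.H (fun t y => inner ℝ (φ y) (f t)) i j x| ≤
      B * postSd I.k I.lam S x := by
  have hB : 0 ≤ B := (norm_nonneg _).trans (hf 1)
  set w := postWeights I.k I.lam S x
  set fbar : E := (size I.T I.H i j : ℝ)⁻¹ • ∑ m, f (time I.T I.H i j m) with hfbar
  have hinner : ∀ y, inner ℝ (φ y) fbar =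
      (∑ m, inner ℝ (φ y) (f (time I.T I.H i j m))) / (size I.T I.H i j : ℝ) := fun y => by
    rw [hfbar, inner_smul_right, inner_sum, div_eq_inv_mul]
  have hnorm : ‖fbar‖ ≤ B := by
    rw [hfbar, norm_smul, norm_inv, Real.norm_natCast]
    refine inv_mul_le_of_le_mul₀ (by positivity) hB ?_
    calc ‖∑ m, f (time I.T I.H i j m)‖ ≤ ∑ m, ‖f (time I.T I.H i j m)‖ := norm_sum_le _ _
      _ ≤ ∑ _m : Fin (size I.T I.H i j), B := Finset.sum_le_sum fun m _ => hf _
      _ = size I.T I.H i j * B := by simp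
  have heq : ∑ a, w a * ((∑ m, inner ℝ (φ (S a)) (f (time I.T I.H i j m))) / (size I.T I.H i j : ℝ)) -
      avgReward I.T I.H (fun t y => inner ℝ (φ y) (f t)) i j x =
      -inner ℝ (φ x - ∑ a, w a • φ (S a)) fbar := by
    rw [inner_sub_left, sum_inner]
    simp only [inner_smul_left, hinner, avgReward]
    simp
  rw [heq, abs_neg]
  calc _ ≤ ‖φ x - ∑ a, w a • φ (S a)‖ * ‖fbar‖ := abs_real_inner_le_norm _ _
    _ ≤ postSd I.k I.lam S x * B :=
        mul_le_mul (norm_sub_sum_postWeights_le_postSd hφ hlam S x) hnorm (norm_nonneg _)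
          (Real.sqrt_nonneg _)
    _ = _ := mul_comm _ _

/-- Failure probability of the confidence bounds of one batch run with a fixed set of potential
maximizers. -/
theorem measure_batch_deviation_le [MeasurableSpace Ω] {P : Measure Ω} [IsProbabilityMeasure P]
    (hφ : ∀ x y, inner ℝ (φ x) (φ y) = I.k x y)
    (hlam : 0 < I.lam) (hf : ∀ t, ‖f t‖ ≤ B) (hk1 : ∀ x, I.k x x ≤ 1) {ρ : ℝ≥0}
    (hε : IsNoise P ρ ε) (hψ : IsUniformPerms P I.T I.H ψ)
    (hind : IndepFun (fun ω t => ε t ω) (fun ω i j => ψ i j ω) P) {L : ℝ} (hL : 0 ≤ L)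
    (hwidth : I.width = B * (4 * √2 / √I.lam * √L + 1) + ρ / √I.lam * √(2 * L))
    (i : ℕ+) (j : ℕ) (A : Finset 𝒳) (x : 𝒳) :
    P {ω | I.width * postSd I.k I.lam (queries I (fun i j => ψ i j ω) i j A) x <
      |postMean I.k I.lam (queries I (fun i j => ψ i j ω) i j A)
        (observations I (fun t y => inner ℝ (φ y) (f t)) (fun t => ε t ω) (fun i j => ψ i j ω)
          i j A) x
        - avgReward I.T I.H (fun t y => inner ℝ (φ y) (f t)) i j x|} ≤
      ENNReal.ofReal (2 * Real.exp (-L)) := by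
  have hB : 0 ≤ B := (norm_nonneg _).trans (hf 1)
  have hk : ∀ x y, I.k x y = I.k y x := fun x y => by rw [← hφ, ← hφ, real_inner_comm]
  set S := candidates I i j A (size I.T I.H i j) with hS
  set w := postWeights I.k I.lam S x with hw
  set sd := postSd I.k I.lam S x with hsd
  have hsd0 : 0 ≤ sd := Real.sqrt_nonneg _
  have hφ1 : ∀ y, ‖φ y‖ ≤ 1 := fun y => by
    have := hk1 y
    rw [← hφ, real_inner_self_eq_norm_sq] at this
    exact (sq_le_one_iff₀ (norm_nonneg _)).mp this
  have hπset : ∀ p, MeasurableSet (ψ i j ⁻¹' {p}) := fun p =>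
    hψ.measurable i j (MeasurableSpace.measurableSet_top)
  let c : ℝ≥0 := ((4 * B + ρ) ^ 2 * ∑ a, w a ^ 2).toNNReal
  have hc : (c : ℝ) = (4 * B + ρ) ^ 2 * ∑ a, w a ^ 2 := Real.coe_toNNReal _ (by positivity)
  have hZ := hasSubgaussianMGF_permuted_sum (P := P) w
    (fun m a => inner ℝ (φ (S a)) (f (time I.T I.H i j m))) hB
    (fun m a => (abs_real_inner_le_norm _ _).trans
      ((mul_le_mul (hφ1 _) (hf _) (norm_nonneg _) zero_le_one).trans_eq (one_mul B)))
    (π := ψ i j) hπset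
    (fun p => by
      rw [← map_measureReal_apply (hψ.measurable i j) MeasurableSpace.measurableSet_top,
        hψ.uniform i j, measureReal_def, uniformOn_univ, Measure.count_singleton]
      simp [Fintype.card_perm])
    (ξ := fun m => ε (time I.T I.H i j m)) (hε.indep.precomp (time_injective _ _ _ _))
    (fun m => hε.subgaussian _)
    (fun p t => by
      have h1 : Measurable fun q : (∀ (i : ℕ+) (j : ℕ), Equiv.Perm (Fin (size I.T I.H i j))) =>
          ({p} : Set _).indicator (fun _ => (1 : ℝ)) (q i j) :=
        (measurable_const.indicator MeasurableSpace.measurableSet_top).comp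
          ((measurable_pi_apply j).comp (measurable_pi_apply i))
      have h2 : Measurable fun e : ℕ+ → ℝ =>
          Real.exp (t * ∑ m, w (p m) * e (time I.T I.H i j m)) := by fun_prop
      exact hind.symm.comp h1 h2)
    hc
  refine le_trans (measure_mono ?_) (measure_lt_abs_le_exp_neg hZ hL)
  refine Set.ofPred_subset_ofPred.mpr fun ω hω => ?_
  rw [postSd_queries, postMean_queries_observations hk, ← hS, ← hw, ← hsd] at hω
  have hbias := abs_sum_postWeights_mul_sub_avgReward_le hφ hlam hf i j S x
  rw [← hw, ← hsd] at hbias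
  have hsqrtc : √(c : ℝ) ≤ (4 * B + ρ) * (sd / √I.lam) := by
    rw [hc, Real.sqrt_mul (by positivity), Real.sqrt_sq (by positivity)]
    exact mul_le_mul_of_nonneg_left (sqrt_sum_postWeights_sq_le hφ hlam S x) (by positivity)
  have hmain : √(c : ℝ) * √(2 * L) + B * sd ≤ I.width * sd := by
    calc √(c : ℝ) * √(2 * L) + B * sd
        ≤ (4 * B + ρ) * (sd / √I.lam) * √(2 * L) + B * sd := by gcongr
      _ = I.width * sd := by
          rw [hwidth, Real.sqrt_mul (by norm_num)]
          ring
  have htri := abs_sub_le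
    (∑ m, w (ψ i j ω m) * (inner ℝ (φ (S (ψ i j ω m))) (f (time I.T I.H i j m)) +
      ε (time I.T I.H i j m) ω))
    (∑ a, w a * ((∑ m, inner ℝ (φ (S a)) (f (time I.T I.H i j m))) / (size I.T I.H i j : ℝ)))
    (avgReward I.T I.H (fun t y => inner ℝ (φ y) (f t)) i j x)
  linarith

end Batch

section Information

variable {𝒳 : Type*} {I : Input 𝒳} {Ω : Type*}

/-- The σ-algebras generated by the individual noise variables (index `Sum.inl t`) and permutations
(index `Sum.inr (i, j)`). -/
noncomputable abbrev sourceSpace {T H : ℕ} (ε : ℕ+ → Ω → ℝ)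
    (ψ : ∀ (i : ℕ+) (j : ℕ), Ω → Equiv.Perm (Fin (size T H i j))) :
    ℕ+ ⊕ (ℕ+ × ℕ) → MeasurableSpace Ω :=
  Sum.elim (fun t => MeasurableSpace.comap (ε t) inferInstance)
    (fun p => MeasurableSpace.comap (ψ p.1 p.2) inferInstance)

/-- The sources of randomness that enter the `j`-th batch of the `i`-th interval. -/
noncomputable def batchSources (T H : ℕ) (i : ℕ+) (j : ℕ) : Set (ℕ+ ⊕ (ℕ+ × ℕ)) :=
  insert (Sum.inr (i, j)) (Set.range fun m => Sum.inl (time T H i j m))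

/-- The sources of randomness that enter the batches `1, …, j - 1` of the `i`-th interval. -/
noncomputable def pastSources (T H : ℕ) (i : ℕ+) (j : ℕ) : Set (ℕ+ ⊕ (ℕ+ × ℕ)) :=
  ⋃ l ∈ Set.Ico 1 j, batchSources T H i l

variable {ε : ℕ+ → Ω → ℝ} {ψ : ∀ (i : ℕ+) (j : ℕ), Ω → Equiv.Perm (Fin (size I.T I.H i j))}

theorem disjoint_pastSources_batchSources (T H : ℕ) (i : ℕ+) (j : ℕ) :
    Disjoint (pastSources T H i j) (batchSources T H i j) := by
  rw [Set.disjoint_left]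
  intro s hs hs'
  simp only [pastSources, Set.mem_iUnion, Set.mem_Ico] at hs
  obtain ⟨l, ⟨hl, hlj⟩, hs⟩ := hs
  rcases hs with rfl | ⟨m, rfl⟩
  · rcases hs' with h | ⟨m', h⟩
    · simp only [Sum.inr.injEq, Prod.mk.injEq, true_and] at h
      omega
    · cases h
  · rcases hs' with h | ⟨m', h⟩
    · cases h
    · exact time_ne_of_lt hl hlj m m' (Sum.inl_injective h).symm

theorem iIndep_sourceSpace [MeasurableSpace Ω] {P : Measure Ω} {T H : ℕ} {ρ : ℝ≥0}
    {ε : ℕ+ → Ω → ℝ} {ψ : ∀ (i : ℕ+) (j : ℕ), Ω → Equiv.Perm (Fin (size T H i j))} (hε : IsNoise P ρ ε)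
    (hψ : IsUniformPerms P T H ψ)
    (hind : IndepFun (fun ω t => ε t ω) (fun ω i j => ψ i j ω) P) :
    iIndep (sourceSpace ε ψ) P := by
  refine iIndep_sumElim hε.indep.iIndep hψ.indep.iIndep ?_
  refine indep_of_indep_of_le ((IndepFun_iff_Indep _ _ _).mp hind) ?_ ?_
  · refine iSup_le fun t => ?_
    rw [← measurable_iff_comap_le]
    exact (measurable_pi_apply t).comp (comap_measurable (fun ω t => ε t ω))
  · refine iSup_le fun p => ?_
    rw [← measurable_iff_comap_le]
    have h : Measurable fun q : (∀ (i : ℕ+) (j : ℕ), Equiv.Perm (Fin (size T H i j))) =>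
        q p.1 p.2 := (measurable_pi_apply p.2).comp (measurable_pi_apply p.1)
    exact h.comp (comap_measurable (fun ω i j => ψ i j ω))

theorem measurable_noise_of_batchSources_subset {T H : ℕ} {ε : ℕ+ → Ω → ℝ}
    {ψ : ∀ (i : ℕ+) (j : ℕ), Ω → Equiv.Perm (Fin (size T H i j))} {i : ℕ+} {j : ℕ}
    {R : Set (ℕ+ ⊕ (ℕ+ × ℕ))} (hR : batchSources T H i j ⊆ R) (m : Fin (size T H i j)) :
    Measurable[⨆ s ∈ R, sourceSpace ε ψ s] (ε (time T H i j m)) := by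
  rw [measurable_iff_comap_le]
  exact le_iSup₂ (f := fun s (_ : s ∈ R) => sourceSpace ε ψ s) (Sum.inl (time T H i j m))
    (hR (Set.mem_insert_of_mem _ ⟨m, rfl⟩))

theorem measurableSet_perm_of_batchSources_subset {T H : ℕ} {ε : ℕ+ → Ω → ℝ}
    {ψ : ∀ (i : ℕ+) (j : ℕ), Ω → Equiv.Perm (Fin (size T H i j))} {i : ℕ+} {j : ℕ}
    {R : Set (ℕ+ ⊕ (ℕ+ × ℕ))} (hR : batchSources T H i j ⊆ R)
    (p : Equiv.Perm (Fin (size T H i j))) :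
    MeasurableSet[⨆ s ∈ R, sourceSpace ε ψ s] (ψ i j ⁻¹' {p}) :=
  le_iSup₂ (f := fun s (_ : s ∈ R) => sourceSpace ε ψ s) (Sum.inr (i, j))
    (hR (Set.mem_insert _ _)) _ ⟨{p}, MeasurableSpace.measurableSet_top, rfl⟩

theorem measurableSet_filter_eq {m : MeasurableSpace Ω} [Finite 𝒳] (A A' : Finset 𝒳)
    {l u : 𝒳 → Ω → ℝ} (hl : ∀ x, Measurable (l x)) (hu : ∀ x, Measurable (u x)) :
    MeasurableSet {ω | ∀ x, (x ∈ A ∧ ∀ x' ∈ A, l x' ω ≤ u x ω) ↔ x ∈ A'} := by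
  have hle : ∀ x x', MeasurableSet {ω | l x' ω ≤ u x ω} := fun x x' =>
    measurableSet_le (hl x') (hu x)
  refine measurableSet_setOfPred.mpr (Measurable.forall fun x => ?_)
  refine Measurable.iff (Measurable.and measurable_const
    (Measurable.forall fun x' => Measurable.imp measurable_const ?_)) measurable_const
  exact measurableSet_setOfPred.mp (hle x x')

theorem measurableSet_potentialMaximizers [Fintype 𝒳] (hk : ∀ x y, I.k x y = I.k y x)
    (F : ℕ+ → 𝒳 → ℝ) (i : ℕ+) : ∀ (j : ℕ) (A : Finset 𝒳),
    MeasurableSet[⨆ s ∈ pastSources I.T I.H i j, sourceSpace ε ψ s]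
      ((fun ω => potentialMaximizers I F (fun t => ε t ω) (fun i j => ψ i j ω) i j) ⁻¹' {A})
  | 0, A => by
    simp only [potentialMaximizers]
    exact measurable_const (MeasurableSpace.measurableSet_top (s := {A}))
  | 1, A => by
    simp only [potentialMaximizers]
    exact measurable_const (MeasurableSpace.measurableSet_top (s := {A}))
  | j + 2, A => by
    classical
    set R := pastSources I.T I.H i (j + 2) with hR
    have hsub : batchSources I.T I.H i (j + 1) ⊆ R :=
      Set.subset_biUnion_of_mem (u := fun l => batchSources I.T I.H i l)
        (Set.mem_Ico.mpr ⟨by omega, by omega⟩)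
    have hmono : pastSources I.T I.H i (j + 1) ⊆ R :=
      Set.biUnion_subset_biUnion_left (Set.Ico_subset_Ico le_rfl (by omega))
    have hmean : ∀ A' x, Measurable[⨆ s ∈ R, sourceSpace ε ψ s] fun ω =>
        postMean I.k I.lam (queries I (fun i j => ψ i j ω) i (j + 1) A')
          (observations I F (fun t => ε t ω) (fun i j => ψ i j ω) i (j + 1) A') x := fun A' x =>
      measurable_postMean_queries hk F (measurable_noise_of_batchSources_subset hsub)
        (measurableSet_perm_of_batchSources_subset hsub) A' x
    have hset : ((fun ω => potentialMaximizers I F (fun t => ε t ω) (fun i j => ψ i j ω) i (j + 2))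
        ⁻¹' {A}) = ⋃ A' : Finset 𝒳,
        ((fun ω => potentialMaximizers I F (fun t => ε t ω) (fun i j => ψ i j ω) i (j + 1))
          ⁻¹' {A'}) ∩ {ω | ∀ x, (x ∈ A' ∧ ∀ x' ∈ A',
            lcbWith I F (fun t => ε t ω) (fun i j => ψ i j ω) i (j + 1) A' x' ≤
              ucbWith I F (fun t => ε t ω) (fun i j => ψ i j ω) i (j + 1) A' x) ↔ x ∈ A} := by
      ext ω
      rw [Set.mem_iUnion]
      simp only [potentialMaximizers, Set.mem_inter_iff, Set.mem_preimage, Set.mem_singleton_iff,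
        Set.mem_ofPred_eq, exists_eq_left', Finset.ext_iff (s₂ := A), Finset.mem_filter]
    rw [hset]
    refine MeasurableSet.iUnion fun A' => MeasurableSet.inter ?_ ?_
    · exact biSup_mono (f := sourceSpace ε ψ) (fun s hs => hmono hs) _
        (measurableSet_potentialMaximizers hk F i (j + 1) A')
    · simp only [lcbWith, ucbWith, postSd_queries]
      exact measurableSet_filter_eq A' A (fun x' => (hmean A' x').sub measurable_const)
        (fun x => (hmean A' x).add measurable_const)

end Information

end RPERP

/-! ### Union bound -/

namespace RPERP

theorem lcb_le_and_le_ucb_of_abs_sub_le {𝒳 : Type*} [Fintype 𝒳] {I : Input 𝒳} {F : ℕ+ → 𝒳 → ℝ}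
    {e : ℕ+ → ℝ} {π : Perms I.T I.H} {i : ℕ+} {j : ℕ} {x : 𝒳} {r : ℝ}
    (h : |postMean I.k I.lam (queries I π i j (potentialMaximizers I F e π i j))
        (observations I F e π i j (potentialMaximizers I F e π i j)) x - r| ≤
      I.width * postSd I.k I.lam (queries I π i j (potentialMaximizers I F e π i j)) x) :
    lcb I F e π i j x ≤ r ∧ r ≤ ucb I F e π i j x := by
  have habs := abs_le.mp h
  rw [lcb, ucb, lcbWith, ucbWith]
  constructor <;> linarith [habs.1, habs.2]

theorem one_le_QTH {T H : ℕ} (hH : 2 ≤ H) (hHT : H ≤ T) : 1 ≤ QTH T H := by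
  have hH2 : (2 : ℝ) ≤ H := by exact_mod_cast hH
  have hT : (0 : ℝ) < T := by exact_mod_cast (by omega : 0 < T)
  have hlogH : 1 ≤ Real.logb 2 H := by
    rw [Real.le_logb_iff_rpow_le (by norm_num) (by linarith)]
    simpa using hH2
  have hnn : 0 ≤ Real.logb 2 (Real.logb 2 H) := Real.logb_nonneg (by norm_num) hlogH
  have hM : (1 : ℝ) ≤ ⌈(T : ℝ) / (H : ℝ)⌉₊ := by
    exact_mod_cast Nat.one_le_iff_ne_zero.mpr
      (Nat.ceil_pos.mpr (div_pos hT (by linarith))).ne'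
  exact one_le_mul_of_one_le_of_one_le hM (by linarith)

theorem sum_numBatches_sub_one_le {T H : ℕ} (hH : 2 ≤ H) :
    ∑ i ∈ Finset.range ⌈(T : ℝ) / (H : ℝ)⌉₊,
      ((numBatches (intervalLen T H i.succPNat) - 1 : ℕ) : ℝ) ≤ QTH T H := by
  calc _ ≤ ∑ _i ∈ Finset.range ⌈(T : ℝ) / (H : ℝ)⌉₊, (1 + Real.logb 2 (Real.logb 2 H)) :=
        Finset.sum_le_sum fun i _ => numBatches_sub_one_le hH (min_le_left _ _)
    _ = QTH T H := by rw [Finset.sum_const, Finset.card_range, nsmul_eq_mul, QTH]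

/-- The union bound over all intervals, batches and inputs costs the factor `|𝒳| Q_{T,H}`. -/
theorem measure_exists_batch_le {Ω 𝒳 : Type*} [MeasurableSpace Ω] (P : Measure Ω) [Fintype 𝒳]
    [Nonempty 𝒳] {T H : ℕ} (hH : 2 ≤ H) (hHT : H ≤ T) {δ : ℝ} (hδ : 0 < δ)
    (S : ℕ+ → ℕ → 𝒳 → Set Ω)
    (hS : ∀ i j x, P (S i j x) ≤
      ENNReal.ofReal (2 * Real.exp (-Real.log (4 * (Fintype.card 𝒳 : ℝ) * QTH T H / δ)))) :
    P {ω | ∃ i : ℕ+, (i : ℕ) ≤ ⌈(T : ℝ) / (H : ℝ)⌉₊ ∧ ∃ j : ℕ, 1 ≤ j ∧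
      j ≤ numBatches (intervalLen T H i) - 1 ∧ ∃ x, ω ∈ S i j x} ≤ ENNReal.ofReal δ := by
  set L := Real.log (4 * (Fintype.card 𝒳 : ℝ) * QTH T H / δ) with hL
  set M := ⌈(T : ℝ) / (H : ℝ)⌉₊
  have hQ := one_le_QTH hH hHT
  have hcard : (0 : ℝ) < Fintype.card 𝒳 := by exact_mod_cast Fintype.card_pos
  have hexp : Real.exp (-L) = δ / (4 * (Fintype.card 𝒳 : ℝ) * QTH T H) := by
    rw [hL, Real.exp_neg, Real.exp_log (by positivity), inv_div]
  calc _ ≤ P (⋃ i ∈ Finset.range M,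
        ⋃ j ∈ Finset.Icc 1 (numBatches (intervalLen T H i.succPNat) - 1),
          ⋃ x ∈ (Finset.univ : Finset 𝒳), S i.succPNat j x) := by
        refine measure_mono fun ω hω => ?_
        obtain ⟨i, hi, j, hj1, hj, x, hx⟩ := hω
        have hi' : (i.natPred).succPNat = i := PNat.succPNat_natPred i
        have hlt : i.natPred < M := by
          have := PNat.natPred_add_one i
          omega
        simp only [Set.mem_iUnion, Finset.mem_range, Finset.mem_Icc]
        exact ⟨i.natPred, hlt, j, ⟨hj1, by rwa [hi']⟩, x, Finset.mem_univ _, by rwa [hi']⟩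
    _ ≤ ∑ i ∈ Finset.range M, ∑ j ∈ Finset.Icc 1 (numBatches (intervalLen T H i.succPNat) - 1),
          ∑ x : 𝒳, P (S i.succPNat j x) := by
        refine (measure_biUnion_finset_le _ _).trans (Finset.sum_le_sum fun i _ => ?_)
        refine (measure_biUnion_finset_le _ _).trans (Finset.sum_le_sum fun j _ => ?_)
        exact measure_biUnion_finset_le _ _
    _ ≤ ∑ i ∈ Finset.range M, ∑ _j ∈ Finset.Icc 1 (numBatches (intervalLen T H i.succPNat) - 1),
          ∑ _x : 𝒳, ENNReal.ofReal (2 * Real.exp (-L)) := by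
        gcongr
        exact hS _ _ _
    _ = ENNReal.ofReal (∑ i ∈ Finset.range M,
          ((numBatches (intervalLen T H i.succPNat) - 1 : ℕ) : ℝ) *
            (Fintype.card 𝒳 * (2 * Real.exp (-L)))) := by
        rw [ENNReal.ofReal_sum_of_nonneg fun i _ => by positivity]
        refine Finset.sum_congr rfl fun i _ => ?_
        simp only [Finset.sum_const, Finset.card_univ, Nat.card_Icc, add_tsub_cancel_right,
          nsmul_eq_mul]
        rw [ENNReal.ofReal_mul (Nat.cast_nonneg _), ENNReal.ofReal_mul hcard.le,
          ENNReal.ofReal_natCast, ENNReal.ofReal_natCast]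
    _ ≤ ENNReal.ofReal δ := by
        refine ENNReal.ofReal_le_ofReal ?_
        rw [← Finset.sum_mul]
        calc _ ≤ QTH T H * (Fintype.card 𝒳 * (2 * Real.exp (-L))) :=
              mul_le_mul_of_nonneg_right (sum_numBatches_sub_one_le hH) (by positivity)
          _ = δ / 2 := by
              rw [hexp]
              field_simp
              norm_num
          _ ≤ δ := by linarith

end RPERP

theorem theorem2 :
    ∃ C : ℝ, 0 < C ∧
      ∀ (𝒳 : Type*) [Fintype 𝒳] [Nonempty 𝒳]
        -- what the algorithm is run with
        (I : RPERP.Input 𝒳) (_ : 2 ≤ I.H) (_ : I.H ≤ I.T) (_ : 0 < I.lam)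
        (_ : I.rule.IsArgmax I.k I.lam)
        -- the reproducing kernel Hilbert space of the kernel
        (Hk : Type*) [NormedAddCommGroup Hk] [InnerProductSpace ℝ Hk] [CompleteSpace Hk]
        [RKHS ℝ Hk 𝒳 ℝ]
        (_ : ∀ x y, RKHS.kernel Hk x y (1 : ℝ) = I.k x y)
        (_ : ∀ x, I.k x x ≤ 1)
        -- the reward functions
        (f : ℕ+ → Hk) (B : ℝ) (_ : ∀ t, ‖f t‖ ≤ B)
        -- the noise and the random permutations
        (Ω : Type*) [MeasurableSpace Ω] (P : Measure Ω) [IsProbabilityMeasure P]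
        (ρ : ℝ≥0) (ε : ℕ+ → Ω → ℝ) (_ : RPERP.IsNoise P ρ ε)
        (ψ : ∀ (i : ℕ+) (j : ℕ), Ω → Equiv.Perm (Fin (RPERP.size I.T I.H i j)))
        (_ : RPERP.IsUniformPerms P I.T I.H ψ)
        (_ : IndepFun (fun ω t => ε t ω) (fun ω i j => ψ i j ω) P)
        -- the confidence level and width
        (δ : ℝ) (_ : 0 < δ) (_ : δ < 1)
        (_ : I.width = RPERP.sqrtBeta I.T I.H (Fintype.card 𝒳) B C I.lam ρ δ),
        ENNReal.ofReal (1 - δ) ≤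
          P {ω | ∀ i : ℕ+, (i : ℕ) ≤ ⌈(I.T : ℝ) / (I.H : ℝ)⌉₊ →
            ∀ j : ℕ, 1 ≤ j → j ≤ RPERP.numBatches (RPERP.intervalLen I.T I.H i) - 1 → ∀ x : 𝒳,
              RPERP.lcb I (fun t => ⇑(f t)) (fun t => ε t ω) (fun i j => ψ i j ω) i j x
                  ≤ RPERP.avgReward I.T I.H (fun t => ⇑(f t)) i j x ∧
                RPERP.avgReward I.T I.H (fun t => ⇑(f t)) i j x
                  ≤ RPERP.ucb I (fun t => ⇑(f t)) (fun t => ε t ω) (fun i j => ψ i j ω) i j x} := by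
  -- for `C = 4 √2`, the width minus `B` is `(4 B + ρ) / √λ * √(2 L)`
  refine ⟨4 * √2, by positivity, ?_⟩
  intro 𝒳 _ _ I hH hHT hlam _ Hk _ _ _ _ hker hk1 f B hf Ω _ P _ ρ ε hε ψ hψ hind δ hδ hδ1 hwidth
  -- the canonical feature map of the reproducing kernel Hilbert space
  let φ : 𝒳 → Hk := fun x => RKHS.kerFun Hk x (1 : ℝ)
  have heval : ∀ (g : Hk) x, inner ℝ (φ x) g = g x := fun g x => by
    simp [φ]
  have hφ : ∀ x y, inner ℝ (φ x) (φ y) = I.k x y := fun x y => by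
    rw [heval, ← hker, ← RKHS.kerFun_apply]
  have hk : ∀ x y, I.k x y = I.k y x := fun x y => by rw [← hφ, ← hφ, real_inner_comm]
  have hF : (fun t => ⇑(f t)) = fun t y => inner ℝ (φ y) (f t) := by
    funext t y
    exact (heval _ _).symm
  rw [hF]
  rw [RPERP.sqrtBeta] at hwidth
  set F : ℕ+ → 𝒳 → ℝ := fun t y => inner ℝ (φ y) (f t)
  set L := Real.log (4 * (Fintype.card 𝒳 : ℝ) * RPERP.QTH I.T I.H / δ) with hL
  have hL0 : 0 ≤ L := by
    refine Real.log_nonneg ((one_le_div hδ).mpr ?_)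
    have hQ := RPERP.one_le_QTH hH hHT
    have hcard : (1 : ℝ) ≤ Fintype.card 𝒳 := by exact_mod_cast Fintype.card_pos
    nlinarith
  -- the event that the bounds of a batch run with the set `A` fail at `x`
  let S : ℕ+ → ℕ → 𝒳 → Finset 𝒳 → Set Ω := fun i j x A =>
    {ω | I.width * RPERP.postSd I.k I.lam (RPERP.queries I (fun i j => ψ i j ω) i j A) x <
      |RPERP.postMean I.k I.lam (RPERP.queries I (fun i j => ψ i j ω) i j A)
        (RPERP.observations I F (fun t => ε t ω) (fun i j => ψ i j ω) i j A) x
        - RPERP.avgReward I.T I.H F i j x|}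
  let A : ℕ+ → ℕ → Ω → Finset 𝒳 := fun i j ω =>
    RPERP.potentialMaximizers I F (fun t => ε t ω) (fun i j => ψ i j ω) i j
  have hsrc : ∀ s, RPERP.sourceSpace ε ψ s ≤ ‹MeasurableSpace Ω› := by
    rintro (t | p)
    · exact (hε.measurable t).comap_le
    · exact (hψ.measurable p.1 p.2).comap_le
  have hfail : ∀ i j x, P {ω | ω ∈ S i j x (A i j ω)} ≤
      ENNReal.ofReal (2 * Real.exp (-L)) := fun i j x => by
    refine measure_mem_random_le_of_indep (iSup₂_le fun s _ => hsrc s)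
      (indep_iSup_of_disjoint hsrc (RPERP.iIndep_sourceSpace hε hψ hind)
        (RPERP.disjoint_pastSources_batchSources I.T I.H i j))
      (RPERP.measurableSet_potentialMaximizers hk F i j) (fun A' => ?_)
      (fun A' => RPERP.measure_batch_deviation_le hφ hlam hf hk1 hε hψ hind hL0 hwidth i j A' x)
    simp only [S, RPERP.postSd_queries]
    have hmean := RPERP.measurable_postMean_queries hk F
      (RPERP.measurable_noise_of_batchSources_subset (ε := ε) (ψ := ψ)
        (subset_refl (RPERP.batchSources I.T I.H i j)))
      (RPERP.measurableSet_perm_of_batchSources_subset (subset_refl _)) A' x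
    exact @measurableSet_lt _ _ _ _ _ _ _ _ _ _ _ measurable_const
      (continuous_abs.measurable.comp (hmean.sub measurable_const))
  have hbad := RPERP.measure_exists_batch_le P hH hHT hδ _ hfail
  set G : Set Ω := {ω | ∀ i : ℕ+, (i : ℕ) ≤ ⌈(I.T : ℝ) / (I.H : ℝ)⌉₊ →
    ∀ j : ℕ, 1 ≤ j → j ≤ RPERP.numBatches (RPERP.intervalLen I.T I.H i) - 1 → ∀ x : 𝒳,
      RPERP.lcb I F (fun t => ε t ω) (fun i j => ψ i j ω) i j x
          ≤ RPERP.avgReward I.T I.H F i j x ∧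
        RPERP.avgReward I.T I.H F i j x
          ≤ RPERP.ucb I F (fun t => ε t ω) (fun i j => ψ i j ω) i j x} with hG
  have hGc : P Gᶜ ≤ ENNReal.ofReal δ := by
    refine (measure_mono fun ω hω => ?_).trans hbad
    rw [Set.mem_compl_iff, hG, Set.mem_ofPred_eq] at hω
    push Not at hω
    obtain ⟨i, hi, j, hj1, hj, x, hx⟩ := hω
    rw [Set.mem_ofPred_eq]
    refine ⟨i, hi, j, hj1, hj, x, ?_⟩
    rw [Set.mem_ofPred_eq]
    by_contra hno
    simp only [S, A, Set.mem_ofPred_eq, not_lt] at hno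
    have hbounds := RPERP.lcb_le_and_le_ucb_of_abs_sub_le hno
    exact absurd hbounds.2 (not_le.mpr (hx hbounds.1))
  rw [ENNReal.ofReal_sub _ hδ.le, ENNReal.ofReal_one, tsub_le_iff_right]
  calc (1 : ENNReal) = P Set.univ := measure_univ.symm
    _ ≤ P (G ∪ Gᶜ) := by rw [Set.union_compl_self]
    _ ≤ P G + P Gᶜ := measure_union_le _ _
    _ ≤ P G + ENNReal.ofReal δ := by gcongr
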